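/- All graphs are finite and simple. Let $T=(V,E)$ be a tree. The height of a vertex $v$ is the least distance from $v$ to a leaf (a vertex of degree $1$), an isolated vertex having height $0$; the height of $T$ is the largest height of a vertex. The tree $T$ is balanced if no two vertices of the same height are adjacent. A set $D\subseteq V$ is a total dominating set if every vertex of $T$ is adjacent to an element of $D$, and $T$ is unmixed if all inclusion-minimal total dominating sets of $T$ have the same size. For $n\ge 0$ let $P_n$ be the path with vertices $0,1,\dots,n$ and edges $\{i,i+1\}$, so that $P_n$ has $n$ edges. For a tree $G$ and a vertex $v$ of $G$ of height $1$, $2$ or $3$, let $\mathcal{O}(G,v)$ be the tree obtained from the disjoint union of $G$ and, respectively, $P_0$, $P_3$ or $P_2$ by adding an edge joining $v$ to the last vertex ($0$, $3$ or $2$, respectively) of that path; that is, a whisker of length $1$, $4$ or $3$ is attached at $v$. Inductively, for $k\ge 2$, $\mathcal{O}(G,(v_1,\dots,v_k)) := \mathcal{O}(\mathcal{O}(G,(v_1,\dots,v_{k-1})),v_k)$, with $\mathcal{O}(G,(v_1)):=\mathcal{O}(G,v_1)$, where each $v_j$ is a vertex of height $1$, $2$ or $3$ of the tree constructed from $v_1,\dots,v_{j-1}$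 (of $G$ itself if $j=1$). **Theorem.** Let $T$ be an unmixed balanced tree of height $3$. Then either $T\cong P_6$, or there exist $k\ge 1$ and a sequence of vertices $v_1,\dots,v_k$ as above such that $T\cong\mathcal{O}(P_6,(v_1,\dots,v_k))$. -/

import Mathlib

namespace WhiskerTrees

/-- A leaf is a vertex of degree `1`. -/
def IsLeaf {V : Type*} (G : SimpleGraph V) (v : V) : Prop :=
  (G.neighborSet v).ncard = 1

/-- The height of `v`: the least distance from `v` to a leaf. An isolated vertex reaches no leaf,
so the set below is empty and its height is `sInf ∅ = 0`, which is the usual convention. -/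
noncomputable def vertexHeight {V : Type*} (G : SimpleGraph V) (v : V) : ℕ :=
  sInf {d : ℕ | ∃ l : V, IsLeaf G l ∧ G.Reachable v l ∧ G.dist v l = d}

/-- The height of a finite graph: the maximum of the heights of its vertices. -/
noncomputable def graphHeight {V : Type*} (G : SimpleGraph V) : ℕ :=
  sSup (Set.range (vertexHeight G))

/-- A tree is balanced if no two vertices of the same height are adjacent. -/
def IsBalanced {V : Type*} (G : SimpleGraph V) : Prop :=
  ∀ u v : V, G.Adj u v → vertexHeight G u ≠ vertexHeight G v

/-- The open neighborhood `N(D)` of a set `D` of vertices. -/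
def openNeighborhood {V : Type*} (G : SimpleGraph V) (D : Set V) : Set V :=
  ⋃ v ∈ D, G.neighborSet v

/-- `D` is a total dominating set if `N(D)` is the whole vertex set. -/
def IsTotalDominating {V : Type*} (G : SimpleGraph V) (D : Set V) : Prop :=
  openNeighborhood G D = Set.univ

/-- A finite graph is unmixed if all its minimal total dominating sets have the same size. -/
def IsUnmixed {V : Type*} (G : SimpleGraph V) : Prop :=
  ∀ D D' : Set V, Minimal (IsTotalDominating G) D → Minimal (IsTotalDominating G) D' →
    D.ncard = D'.ncard

/-- The path `P_n` with `n` edges, on the vertices `0, 1, …, n`. -/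
abbrev path (n : ℕ) : SimpleGraph (Fin (n + 1)) :=
  SimpleGraph.pathGraph (n + 1)

/-- The edge join of `G` and `H`: their disjoint union together with the edge from `v` to `w`. -/
def edgeJoin {V W : Type*} (G : SimpleGraph V) (H : SimpleGraph W) (v : V) (w : W) :
    SimpleGraph (V ⊕ W) :=
  SimpleGraph.sum G H ⊔ SimpleGraph.edge (Sum.inl v) (Sum.inr w)

/-- A graph bundled with its vertex type. -/
structure BundledGraph where
  V : Type
  graph : SimpleGraph V

/-- The index `n` of the path `P_n` that is attached at a vertex of height `1`, `2` or `3`. -/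
def whiskerIndex (h : ℕ) : ℕ :=
  if h = 1 then 0 else if h = 2 then 3 else 2

/-- The vertices of height `1`, `2` or `3`, at which a whisker may be attached. -/
def Attachable (G : BundledGraph) : Type :=
  {v : G.V // 1 ≤ vertexHeight G.graph v ∧ vertexHeight G.graph v ≤ 3}

/-- The operation `O(G, v)`: the edge join of `G` with `P_0`, `P_3` or `P_2`, if `v` has height
`1`, `2` or `3` respectively, by an edge from `v` to the last vertex of that path. -/
noncomputable def attachWhisker (G : BundledGraph) (v : Attachable G) : BundledGraph where
  V := G.V ⊕ Fin (whiskerIndex (vertexHeight G.graph v.1) + 1)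
  graph := edgeJoin G.graph (path (whiskerIndex (vertexHeight G.graph v.1))) v.1 (Fin.last _)

/-- Recursion on `k` that defines at once the type of the sequences `(v₁, …, v_k)` that are
admissible for `G` and the graph `O(G, (v₁, …, v_k))` that belongs to each of them: here `v_j` is a
vertex of height `1`, `2` or `3` of `O(G, (v₁, …, v_{j-1}))`, and
`O(G, (v₁, …, v_k)) = O(O(G, (v₁, …, v_{k-1})), v_k)`. -/
noncomputable def whiskerData (G : BundledGraph) : ℕ → Σ S : Type, (S → BundledGraph)
  | 0 => ⟨Unit, fun _ => G⟩
  | k + 1 =>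
    ⟨Σ s : (whiskerData G k).1, Attachable ((whiskerData G k).2 s),
      fun p => attachWhisker ((whiskerData G k).2 p.1) p.2⟩

/-- The admissible sequences `(v₁, …, v_k)` for `G`. -/
def VertexSeq (G : BundledGraph) (k : ℕ) : Type :=
  (whiskerData G k).1

/-- The graph `O(G, (v₁, …, v_k))`. -/
noncomputable def attachWhiskers (G : BundledGraph) {k : ℕ} (s : VertexSeq G k) : BundledGraph :=
  (whiskerData G k).2 s

/-- The path `P_6`, bundled. -/
def P6 : BundledGraph where
  V := Fin 7
  graph := path 6

end WhiskerTrees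

/-! Every edge joins vertices of consecutive heights. Let `S` be a set of height-2 vertices that
dominates height 3 and whose members have private neighbors. All height-1 vertices, `S`, and one
leaf at each height-1 vertex not adjacent to `S` form a minimal total dominating set
(`exists_minimal_totalDominating`). Unmixedness therefore makes |S| − |N₁(S)| independent of `S`,
where N₁(S) is the set of height-1 vertices adjacent to `S`. Testing this on sets of children in a
rooted tree shows that the edges between heights 1 and 2 form a perfect matching
(`existsUnique_height_one_neighbor`, `existsUnique_height_two_neighbor`).

From then on only the matching matters. A tree with such a matching is P₆ or has a whisker
(`iso_path_or_exists_pendantPath`) whose removal keeps the remaining heights and the matching.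
Peeling whiskers by induction on the number of vertices ends at P₆. -/

namespace WhiskerTrees

/-! ### Distances in trees and the height function -/

section Trees

variable {V : Type*} {T : SimpleGraph V}

/-- Uniqueness of the parent in the tree rooted at `r`: geodesics to `b` and `c`, extended to `a`,
are paths with the same ends, hence equal. -/
theorem tree_closer_neighbor_unique (hT : T.IsTree) (r : V) {a b c : V}
    (hab : T.Adj a b) (hac : T.Adj a c) (hb : T.dist r a = T.dist r b + 1)
    (hc : T.dist r a = T.dist r c + 1) : b = c := by
  obtain ⟨p, hp⟩ := hT.connected.exists_walk_length_eq_dist r b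
  obtain ⟨q, hq⟩ := hT.connected.exists_walk_length_eq_dist r c
  have hp' : (p.concat hab.symm).IsPath :=
    SimpleGraph.Walk.isPath_of_length_eq_dist _ (by simp [hp, hb])
  have hq' : (q.concat hac.symm).IsPath :=
    SimpleGraph.Walk.isPath_of_length_eq_dist _ (by simp [hq, hc])
  have := (hT.existsUnique_path r a).unique hp' hq'
  have h2 := congrArg SimpleGraph.Walk.penultimate this
  simpa using h2

theorem eq_univ_of_adj_closed (hT : T.Connected) {A : Set V} (hne : A.Nonempty)
    (hA : ∀ x ∈ A, ∀ y, T.Adj x y → y ∈ A) : A = Set.univ := by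
  obtain ⟨a, ha⟩ := hne
  refine Set.eq_univ_of_forall fun y => ?_
  obtain ⟨w⟩ := hT a y
  induction w with
  | nil => exact ha
  | cons h _ ih => exact ih (hA _ ha _ h)

theorem lipschitz_walk {h : V → ℕ} (hh : ∀ u v, T.Adj u v → h u ≤ h v + 1) {u v : V}
    (w : T.Walk u v) : h u ≤ h v + w.length := by
  induction w with
  | nil => simp
  | cons hadj _ ih =>
    have := hh _ _ hadj
    simp only [SimpleGraph.Walk.length_cons]
    omega

theorem isLeaf_iff {v : V} : IsLeaf T v ↔ ∃! x, T.Adj v x := by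
  rw [IsLeaf, Set.ncard_eq_one]
  constructor
  · rintro ⟨a, ha⟩
    have h := fun x => Set.ext_iff.1 ha x
    simp only [SimpleGraph.mem_neighborSet, Set.mem_singleton_iff] at h
    exact ⟨a, (h a).2 rfl, fun y hy => (h y).1 hy⟩
  · rintro ⟨a, ha, hu⟩
    refine ⟨a, Set.ext fun x => ⟨fun hx => hu x hx, ?_⟩⟩
    rintro rfl
    exact ha

theorem isTotalDominating_iff {D : Set V} :
    IsTotalDominating T D ↔ ∀ z, ∃ x ∈ D, T.Adj x z := by
  simp [IsTotalDominating, openNeighborhood, Set.eq_univ_iff_forall]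

/-- The properties of the height function of a balanced graph of height `3` without isolated
vertices. -/
structure HeightFunction {V : Type*} (T : SimpleGraph V) (h : V → ℕ) : Prop where
  leaf : ∀ v, h v = 0 ↔ ∃! x, T.Adj v x
  adj : ∀ u v, T.Adj u v → h u = h v + 1 ∨ h v = h u + 1
  le_three : ∀ v, h v ≤ 3
  down : ∀ v k, h v = k + 1 → ∃ x, T.Adj v x ∧ h x = k
  exists_three : ∃ v, h v = 3

/-- Descending steps reach a leaf after `h v` edges, and no walk is faster since `h` changes by one
along an edge. This identifies heights in a peeled tree without recomputing distances. -/
theorem HeightFunction.vertexHeight_eq {h : V → ℕ} (H : HeightFunction T h) (hT : T.Connected)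
    (v : V) : vertexHeight T v = h v := by
  have key : ∀ k v, h v = k → ∃ l, IsLeaf T l ∧ ∃ w : T.Walk v l, w.length = k := by
    intro k
    induction k with
    | zero => exact fun v hv => ⟨v, isLeaf_iff.2 ((H.leaf v).1 hv), .nil, rfl⟩
    | succ k ih =>
      intro v hv
      obtain ⟨x, hx, hk⟩ := H.down v k hv
      obtain ⟨l, hl, w, hw⟩ := ih x hk
      exact ⟨l, hl, .cons hx w, by simp [hw]⟩
  obtain ⟨l, hl, w, hw⟩ := key _ v rfl
  have hlow : ∀ l, IsLeaf T l → h v ≤ T.dist v l := by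
    intro l hl
    obtain ⟨w, hw⟩ := hT.exists_walk_length_eq_dist v l
    have := lipschitz_walk (h := h) (fun a b hab => by have := H.adj a b hab; omega) w
    rw [(H.leaf l).2 (isLeaf_iff.1 hl)] at this
    omega
  apply le_antisymm
  · have hle : vertexHeight T v ≤ T.dist v l := Nat.sInf_le ⟨l, hl, hT v l, rfl⟩
    exact hle.trans ((SimpleGraph.dist_le w).trans hw.le)
  · refine le_csInf (s := {d : ℕ | ∃ l : V, IsLeaf T l ∧ T.Reachable v l ∧ T.dist v l = d})
      ⟨T.dist v l, l, hl, hT v l, rfl⟩ ?_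
    rintro d ⟨l, hl, -, rfl⟩
    exact hlow l hl

theorem heightFunction_vertexHeight [Finite V] (hT : T.IsTree) (hb : IsBalanced T)
    (h3 : graphHeight T = 3) : HeightFunction T (vertexHeight T) := by
  have hconn := hT.connected
  have hne : (Set.range (vertexHeight T)).Nonempty := by
    have := hconn.nonempty
    exact Set.range_nonempty _
  obtain ⟨t, ht⟩ : ∃ v, vertexHeight T v = 3 := by
    have := Nat.sSup_mem hne (Set.finite_range _).bddAbove
    rw [show sSup _ = 3 from h3] at this
    exact this
  have hle : ∀ v, vertexHeight T v ≤ 3 := fun v =>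
    h3 ▸ le_csSup (Set.finite_range _).bddAbove ⟨v, rfl⟩
  -- Without leaves the default `sInf ∅ = 0` would give `t` height 0.
  obtain ⟨l₀, hl₀⟩ : ∃ l, IsLeaf T l := by
    by_contra hno
    have : vertexHeight T t = 0 := by
      rw [vertexHeight, Nat.sInf_eq_zero]
      right
      ext d
      simp only [Set.mem_ofPred_eq, Set.mem_empty_iff_false, iff_false]
      rintro ⟨l, hl, -⟩
      exact hno ⟨l, hl⟩
    omega
  have hup : ∀ v l, IsLeaf T l → vertexHeight T v ≤ T.dist v l := fun v l hl =>
    Nat.sInf_le ⟨l, hl, hconn v l, rfl⟩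
  have hatt : ∀ v, ∃ l, IsLeaf T l ∧ T.dist v l = vertexHeight T v := by
    intro v
    obtain ⟨l, hl, -, hd⟩ := Nat.sInf_mem
      (s := {d : ℕ | ∃ l : V, IsLeaf T l ∧ T.Reachable v l ∧ T.dist v l = d})
      ⟨_, l₀, hl₀, hconn v l₀, rfl⟩
    exact ⟨l, hl, hd⟩
  have hlip : ∀ u v, T.Adj u v → vertexHeight T u ≤ vertexHeight T v + 1 := by
    intro u v huv
    obtain ⟨l, hl, hd⟩ := hatt v
    have h1 := hup u l hl
    have h2 := hconn.dist_triangle (u := u) (v := v) (w := l)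
    rw [SimpleGraph.dist_eq_one_iff_adj.2 huv] at h2
    omega
  refine ⟨fun v => ?_, fun u v huv => ?_, hle, fun v k hv => ?_, t, ht⟩
  · rw [← isLeaf_iff]
    constructor
    · intro hv
      obtain ⟨l, hl, hd⟩ := hatt v
      rw [hv, hconn.dist_eq_zero_iff] at hd
      exact hd ▸ hl
    · intro hv
      have := hup v v hv
      simpa using this
  · have h1 := hlip u v huv
    have h2 := hlip v u huv.symm
    have h4 := hb u v huv
    omega
  · obtain ⟨l, hl, hd⟩ := hatt v
    obtain ⟨w, hw⟩ := hconn.exists_walk_length_eq_dist v l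
    cases w with
    | nil => simp at hd; omega
    | cons hadj q =>
      rename_i x
      refine ⟨x, hadj, ?_⟩
      have h1 := (hup x l hl).trans (SimpleGraph.dist_le q)
      have h2 := hlip v x hadj
      simp only [SimpleGraph.Walk.length_cons] at hw
      omega

end Trees

/-! ### Minimal total dominating sets from sets of height-2 vertices -/

section Domination

variable {V : Type*} {T : SimpleGraph V} {h : V → ℕ}

/-- A set of vertices of height `2` that dominates the vertices of height `3` and each member of
which has a private neighbor extends to a minimal total dominating set. -/
theorem HeightFunction.exists_minimal_totalDominating [Finite V] (H : HeightFunction T h)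
    {S : Set V} (hS : ∀ s ∈ S, h s = 2) (hcov : ∀ u, h u = 3 → ∃ s ∈ S, T.Adj u s)
    (hpriv : ∀ s ∈ S, ∃ x, T.Adj x s ∧ ∀ s' ∈ S, T.Adj x s' → s' = s) :
    ∃ D, Minimal (IsTotalDominating T) D ∧
      D.ncard + {y | h y = 1 ∧ ∃ s ∈ S, T.Adj y s}.ncard = 2 * {y | h y = 1}.ncard + S.ncard := by
  have hlf : ∀ y, ∃ l, h y = 1 → T.Adj y l ∧ h l = 0 := by
    intro y
    by_cases hy : h y = 1
    · obtain ⟨x, hx⟩ := H.down y 0 hy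
      exact ⟨x, fun _ => hx⟩
    · exact ⟨y, fun h => absurd h hy⟩
  choose lf hlf using hlf
  have hleaf : ∀ y z, h y = 1 → T.Adj (lf y) z → z = y := fun y z hy hz =>
    ((H.leaf _).1 (hlf y hy).2).unique hz (hlf y hy).1.symm
  set A : Set V := {y | h y = 1}
  set B : Set V := {y | h y = 1 ∧ ∃ s ∈ S, T.Adj y s}
  have hBA : B ⊆ A := fun y hy => hy.1
  refine ⟨A ∪ S ∪ lf '' (A \ B), ⟨?_, ?_⟩, ?_⟩
  · rw [isTotalDominating_iff]
    intro z
    have h3 := H.le_three z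
    obtain hz | hz | hz | hz : h z = 0 ∨ h z = 1 ∨ h z = 2 ∨ h z = 3 := by omega
    · obtain ⟨x, hx, -⟩ := (H.leaf z).1 hz
      have := H.adj z x hx
      exact ⟨x, .inl (.inl (show h x = 1 by omega)), hx.symm⟩
    · by_cases hzB : z ∈ B
      · obtain ⟨-, s, hs, hzs⟩ := hzB
        exact ⟨s, .inl (.inr hs), hzs.symm⟩
      · exact ⟨lf z, .inr ⟨z, ⟨hz, hzB⟩, rfl⟩, (hlf z hz).1.symm⟩
    · obtain ⟨x, hx, hx1⟩ := H.down z 1 hz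
      exact ⟨x, .inl (.inl hx1), hx.symm⟩
    · obtain ⟨s, hs, hzs⟩ := hcov z hz
      exact ⟨s, .inl (.inr hs), hzs.symm⟩
  · intro D' hD' hsub x hx
    rw [isTotalDominating_iff] at hD'
    -- Minimality: each member is the only dominator of some `z`, namely its chosen leaf for `A`,
    -- the private neighbor for `S`, and the height-1 vertex itself for a chosen leaf.
    suffices ∃ z, ∀ x' ∈ A ∪ S ∪ lf '' (A \ B), T.Adj z x' → x' = x by
      obtain ⟨z, hz⟩ := this
      obtain ⟨x', hx', hadj⟩ := hD' z
      exact hz x' (hsub hx') hadj.symm ▸ hx'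
    rcases hx with (hx | hx) | ⟨y, hy, rfl⟩
    · exact ⟨lf x, fun x' _ hadj => hleaf x x' hx hadj⟩
    · obtain ⟨z, hzx, hz⟩ := hpriv x hx
      refine ⟨z, ?_⟩
      have hx2 := hS x hx
      have h1 := H.adj z x hzx
      rintro x' ((hx' | hx') | ⟨y, hy, rfl⟩) hadj
      · have h2 := H.adj z x' hadj
        have : h x' = 1 := hx'
        omega
      · exact hz x' hx' hadj
      · have := hleaf y z hy.1 hadj.symm
        subst this
        exact absurd ⟨hy.1, x, hx, hzx⟩ hy.2
    · refine ⟨y, ?_⟩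
      have hy1 : h y = 1 := hy.1
      rintro x' ((hx' | hx') | ⟨y', hy', rfl⟩) hadj
      · have h2 := H.adj y x' hadj
        have : h x' = 1 := hx'
        omega
      · exact absurd ⟨hy.1, x', hx', hadj⟩ hy.2
      · rw [hleaf y' y hy'.1 hadj.symm]
  · have hinj : Set.InjOn lf (A \ B) := fun y hy y' hy' heq =>
      hleaf y' y hy'.1 (heq ▸ (hlf y hy.1).1.symm)
    rw [Set.ncard_union_eq, Set.ncard_union_eq, hinj.ncard_image]
    · have := Set.ncard_sdiff_add_ncard_of_subset hBA
      omega
    · rw [Set.disjoint_left]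
      intro y (hy : h y = 1) hyS
      have := hS y hyS
      omega
    · rw [Set.disjoint_left]
      rintro _ hx ⟨y, hy, rfl⟩
      have h0 := (hlf y hy.1).2
      rcases hx with hx | hx
      · have : h (lf y) = 1 := hx
        omega
      · have := hS _ hx
        omega

end Domination

/-! ### The perfect matching between heights 1 and 2 -/

section Matching

variable {V : Type*} {T : SimpleGraph V} {h : V → ℕ}

theorem HeightFunction.exists_ne_neighbor (H : HeightFunction T h) {v x : V} (hv : h v ≠ 0)
    (hx : T.Adj v x) : ∃ y, T.Adj v y ∧ y ≠ x := by
  by_contra hno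
  push Not at hno
  exact hv ((H.leaf v).2 ⟨x, hx, hno⟩)

theorem HeightFunction.exists_child (H : HeightFunction T h) (hT : T.IsTree) (r : V) {v : V}
    (hv : h v ≠ 0) : ∃ x, T.Adj v x ∧ T.dist r x = T.dist r v + 1 := by
  obtain ⟨k, hk⟩ := Nat.exists_eq_succ_of_ne_zero hv
  obtain ⟨x, hx, -⟩ := H.down v k hk
  obtain ⟨y, hy, hyx⟩ := H.exists_ne_neighbor hv hx
  rcases hT.dist_eq_dist_add_one_of_adj r hx with h1 | h1
  · rcases hT.dist_eq_dist_add_one_of_adj r hy with h2 | h2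
    · exact absurd (tree_closer_neighbor_unique hT r hy hx h2 h1) hyx
    · exact ⟨y, hy, h2⟩
  · exact ⟨x, hx, h1⟩

/-- Selects a child for each height-3 vertex. As `u` is the parent of `c u`, all other neighbors of
`c u` lie farther from the root. -/
theorem HeightFunction.exists_child_function (H : HeightFunction T h) (hT : T.IsTree) (r : V) :
    ∃ c : V → V, ∀ u, h u = 3 → T.Adj u (c u) ∧ h (c u) = 2 ∧ T.dist r (c u) = T.dist r u + 1 ∧
      ∀ y, T.Adj (c u) y → y ≠ u → T.dist r y = T.dist r (c u) + 1 := by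
  have : ∀ u, ∃ x, h u = 3 → T.Adj u x ∧ h x = 2 ∧ T.dist r x = T.dist r u + 1 ∧
      ∀ y, T.Adj x y → y ≠ u → T.dist r y = T.dist r x + 1 := by
    intro u
    by_cases hu : h u = 3
    · obtain ⟨x, hx, hd⟩ := H.exists_child hT r (v := u) (by omega)
      refine ⟨x, fun _ => ⟨hx, ?_, hd, fun y hy hyu => ?_⟩⟩
      · have := H.adj u x hx
        have := H.le_three x
        omega
      · rcases hT.dist_eq_dist_add_one_of_adj r hy with h2 | h2
        · exact absurd (tree_closer_neighbor_unique hT r hy hx.symm h2 hd) hyu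
        · exact h2
    · exact ⟨u, fun h => absurd h hu⟩
  exact ⟨_, fun u => (this u).choose_spec⟩

/-- Unmixedness, counted on the sets of `HeightFunction.exists_minimal_totalDominating`. -/
theorem HeightFunction.ncard_add_ncard_eq [Finite V] (H : HeightFunction T h) (hU : IsUnmixed T)
    {S S' : Set V} (hS : ∀ s ∈ S, h s = 2) (hcov : ∀ u, h u = 3 → ∃ s ∈ S, T.Adj u s)
    (hpriv : ∀ s ∈ S, ∃ x, T.Adj x s ∧ ∀ s' ∈ S, T.Adj x s' → s' = s)
    (hS' : ∀ s ∈ S', h s = 2) (hcov' : ∀ u, h u = 3 → ∃ s ∈ S', T.Adj u s)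
    (hpriv' : ∀ s ∈ S', ∃ x, T.Adj x s ∧ ∀ s' ∈ S', T.Adj x s' → s' = s) :
    S.ncard + {y | h y = 1 ∧ ∃ s ∈ S', T.Adj y s}.ncard =
      S'.ncard + {y | h y = 1 ∧ ∃ s ∈ S, T.Adj y s}.ncard := by
  obtain ⟨D, hD, h1⟩ := H.exists_minimal_totalDominating hS hcov hpriv
  obtain ⟨D', hD', h2⟩ := H.exists_minimal_totalDominating hS' hcov' hpriv'
  have := hU D D' hD hD'
  omega

/-- Root at `w` and let `S` consist of chosen children of the height-3 vertices. Both `S` and `S ∪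
{w}` are admissible, and no height-1 neighbor of `w` touches `S`; so adding `w` raises |S| by 1 and
|N₁(S)| by the number of these neighbors, which must be 1. -/
theorem HeightFunction.existsUnique_height_one_neighbor [Finite V] (H : HeightFunction T h)
    (hT : T.IsTree) (hU : IsUnmixed T) {w : V} (hw : h w = 2) :
    ∃! y, T.Adj w y ∧ h y = 1 := by
  obtain ⟨c, hc⟩ := H.exists_child_function hT w
  set S : Set V := c '' {u | h u = 3}
  have hS : ∀ s ∈ S, h s = 2 := by
    rintro _ ⟨u, hu, rfl⟩
    exact (hc u hu).2.1
  have hpar : ∀ y, h y = 1 → ∀ s ∈ S, T.Adj y s → T.dist w y = T.dist w s + 1 := by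
    rintro y hy _ ⟨u, hu, rfl⟩ hadj
    refine (hc u hu).2.2.2 y hadj.symm ?_
    rintro rfl
    have : h y = 3 := hu
    omega
  have hpos : ∀ s ∈ S, T.dist w s ≠ 0 := by
    rintro _ ⟨u, hu, rfl⟩
    have := (hc u hu).2.2.1
    omega
  have hcol : ∀ y, h y = 1 → ∀ s ∈ S, ∀ s' ∈ S, T.Adj y s → T.Adj y s' → s' = s :=
    fun y hy s hs s' hs' h1 h2 =>
      tree_closer_neighbor_unique hT w h2 h1 (hpar y hy s' hs' h2) (hpar y hy s hs h1)
  have hcolw : ∀ y, h y = 1 → T.Adj y w → ∀ s ∈ S, ¬ T.Adj y s := by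
    intro y hy hyw s hs hys
    have h1 := hpar y hy s hs hys
    have h2 := hpos s hs
    rw [SimpleGraph.dist_eq_one_iff_adj.2 hyw.symm] at h1
    omega
  have hdown : ∀ s, h s = 2 → ∃ y, T.Adj s y ∧ h y = 1 := fun s hs => H.down s 1 hs
  have hwS : w ∉ S := fun hwS => hpos w hwS SimpleGraph.dist_self
  have hcov : ∀ u, h u = 3 → ∃ s ∈ S, T.Adj u s := fun u hu => ⟨c u, ⟨u, hu, rfl⟩, (hc u hu).1⟩
  have key := H.ncard_add_ncard_eq hU (S := S) (S' := insert w S) hS hcov ?_ ?_ ?_ ?_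
  · have hunion : {y | h y = 1 ∧ ∃ s ∈ insert w S, T.Adj y s} =
        {y | h y = 1 ∧ ∃ s ∈ S, T.Adj y s} ∪ {y | T.Adj w y ∧ h y = 1} := by
      ext y
      simp only [Set.mem_insert_iff, exists_eq_or_imp, Set.mem_ofPred_eq, Set.mem_union,
        T.adj_comm w y]
      rw [and_or_left, or_comm, and_comm (a := T.Adj y w)]
    rw [hunion, Set.ncard_union_eq, Set.ncard_insert_of_notMem hwS] at key
    · obtain ⟨a, ha⟩ := Set.ncard_eq_one.1
        (show {y | T.Adj w y ∧ h y = 1}.ncard = 1 by omega)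
      have ha' := fun y => Set.ext_iff.1 ha y
      simp only [Set.mem_ofPred_eq, Set.mem_singleton_iff] at ha'
      exact ⟨a, (ha' a).2 rfl, fun y hy => (ha' y).1 hy⟩
    · rw [Set.disjoint_left]
      rintro y ⟨hy, s, hs, hys⟩ ⟨hyw, -⟩
      exact hcolw y hy hyw.symm s hs hys
  · intro s hs
    obtain ⟨y, hsy, hy⟩ := hdown s (hS s hs)
    exact ⟨y, hsy.symm, fun s' hs' h' => hcol y hy s hs s' hs' hsy.symm h'⟩
  · rintro s (rfl | hs)
    exacts [hw, hS s hs]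
  · intro u hu
    obtain ⟨s, hs, hus⟩ := hcov u hu
    exact ⟨s, .inr hs, hus⟩
  · rintro s (rfl | hs)
    · obtain ⟨y, hsy, hy⟩ := hdown s hw
      refine ⟨y, hsy.symm, ?_⟩
      rintro s' (rfl | hs') h'
      · rfl
      · exact absurd h' (hcolw y hy hsy.symm s' hs')
    · obtain ⟨y, hsy, hy⟩ := hdown s (hS s hs)
      refine ⟨y, hsy.symm, ?_⟩
      rintro s' (rfl | hs') h'
      · exact absurd hsy.symm (hcolw y hy h' s hs)
      · exact hcol y hy s hs s' hs' hsy.symm h'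

/-- Otherwise the whole graph is a star of leaves around `v`, leaving no room for height 3. -/
theorem HeightFunction.exists_height_two_neighbor (H : HeightFunction T h) (hT : T.Connected)
    {v : V} (hv : h v = 1) : ∃ w, T.Adj v w ∧ h w = 2 := by
  by_contra hno
  push Not at hno
  have hstar : ∀ x, T.Adj v x → h x = 0 := by
    intro x hx
    have := H.adj v x hx
    have := hno x hx
    omega
  have huniv := eq_univ_of_adj_closed hT (A := {x | x = v ∨ T.Adj v x}) ⟨v, .inl rfl⟩ (by
    rintro x (rfl | hx) y hxy
    · exact .inr hxy
    · exact .inl (((H.leaf x).1 (hstar x hx)).unique hxy hx.symm))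
  obtain ⟨t, ht⟩ := H.exists_three
  have : t ∈ {x | x = v ∨ T.Adj v x} := huniv ▸ Set.mem_univ t
  rcases this with rfl | hvt
  · omega
  · have := hstar t hvt
    omega

/-- Now N₁(S) = `m '' S`, where `m` gives the unique height-1 neighbor. Rooted at `v`, the children
set `S` has `m` injective, so |S| = |m(S)|, and unmixedness forces injectivity on every admissible
set. Two height-2 neighbors `w`, `w'` of `v` would yield an admissible `S'` containing both, with `m
w = m w' = v`. -/
theorem HeightFunction.existsUnique_height_two_neighbor [Finite V] (H : HeightFunction T h)
    (hT : T.IsTree) (hU : IsUnmixed T) {v : V} (hv : h v = 1) :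
    ∃! w, T.Adj v w ∧ h w = 2 := by
  have hmatch : ∀ w, ∃ y, h w = 2 → (T.Adj w y ∧ h y = 1) ∧ ∀ x, T.Adj w x → h x = 1 → x = y := by
    intro w
    by_cases hw : h w = 2
    · obtain ⟨y, hy, hu⟩ := H.existsUnique_height_one_neighbor hT hU hw
      exact ⟨y, fun _ => ⟨hy, fun x hx h1 => hu x ⟨hx, h1⟩⟩⟩
    · exact ⟨w, fun h => absurd h hw⟩
  choose m hm using hmatch
  have himage : ∀ S : Set V, (∀ s ∈ S, h s = 2) →
      {y | h y = 1 ∧ ∃ s ∈ S, T.Adj y s} = m '' S := by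
    intro S hS
    ext y
    constructor
    · rintro ⟨hy, s, hs, hys⟩
      exact ⟨s, hs, ((hm s (hS s hs)).2 y hys.symm hy).symm⟩
    · rintro ⟨s, hs, rfl⟩
      have := (hm s (hS s hs)).1
      exact ⟨this.2, s, hs, this.1.symm⟩
  obtain ⟨w, hw⟩ := H.exists_height_two_neighbor hT.connected hv
  refine ⟨w, hw, fun w' hw' => ?_⟩
  by_contra hne
  obtain ⟨c, hc⟩ := H.exists_child_function hT v
  have hzero : ∀ x, T.dist v x = 0 → v = x := fun x hx => hT.connected.dist_eq_zero_iff.1 hx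
  have hmv : ∀ x, T.Adj v x → h x = 2 → m x = v := fun x hx h2 =>
    ((hm x h2).2 v hx.symm hv).symm
  have hc2 : ∀ u, h u = 3 → h (c u) = 2 := fun u hu => (hc u hu).2.1
  have hpar : ∀ u, h u = 3 → T.dist v (m (c u)) = T.dist v (c u) + 1 := by
    intro u hu
    refine (hc u hu).2.2.2 _ (hm _ (hc2 u hu)).1.1 ?_
    intro heq
    have := (hm _ (hc2 u hu)).1.2
    rw [heq] at this
    omega
  have hcol : ∀ u, h u = 3 → ∀ u', h u' = 3 → m (c u) = m (c u') → c u = c u' := by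
    intro u hu u' hu' heq
    refine tree_closer_neighbor_unique hT v (a := m (c u)) (hm _ (hc2 u hu)).1.1.symm ?_
      (hpar u hu) ?_
    · rw [heq]
      exact (hm _ (hc2 u' hu')).1.1.symm
    · rw [heq]
      exact hpar u' hu'
  have hcolv : ∀ u, h u = 3 → m (c u) ≠ v := by
    intro u hu heq
    have := hpar u hu
    rw [heq, SimpleGraph.dist_self] at this
    omega
  set S : Set V := c '' {u | h u = 3}
  -- Children of height-3 vertices already dominated by `w` or `w'` are omitted, so that such
  -- vertices can be private neighbors of `w` and `w'`.
  set S' : Set V := c '' {u | h u = 3 ∧ ¬ T.Adj u w ∧ ¬ T.Adj u w'} ∪ {w, w'}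
  have hS : ∀ s ∈ S, h s = 2 := by
    rintro _ ⟨u, hu, rfl⟩
    exact hc2 u hu
  have hS' : ∀ s ∈ S', h s = 2 := by
    rintro _ (⟨u, hu, rfl⟩ | rfl | rfl)
    exacts [hc2 u hu.1, hw.2, hw'.2]
  -- The witness is a neighbor of `a` other than `v`: it has height 3 and lies at distance 2 from
  -- `v`. Adjacency to `c u` would put `u` at distance 0, though `h v = 1`.
  have hprivw : ∀ a b, T.Adj v a → h a = 2 → T.Adj v b → h b = 2 → a ≠ b →
      ∃ x, T.Adj x a ∧ ¬ T.Adj x b ∧ ∀ u, h u = 3 → ¬ T.Adj u a → ¬ T.Adj x (c u) := by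
    intro a b ha ha2 hb hb2 hab
    obtain ⟨x, hx, hxv⟩ := H.exists_ne_neighbor (v := a) (by omega) ha.symm
    have hx1 : h x ≠ 1 := by
      intro h1
      rw [(hm a ha2).2 x hx h1, hmv a ha ha2] at hxv
      exact hxv rfl
    have hda := SimpleGraph.dist_eq_one_iff_adj.2 ha
    have hdb := SimpleGraph.dist_eq_one_iff_adj.2 hb
    have hdx : T.dist v x = 2 := by
      have h1 := hT.dist_eq_dist_add_one_of_adj v hx
      have h2 : T.dist v x ≠ 0 := fun h0 => hxv (hzero x h0).symm
      omega
    refine ⟨x, hx.symm, fun hxb => ?_, fun u hu hua hxu => ?_⟩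
    · exact hab (tree_closer_neighbor_unique hT v hx.symm hxb (by omega) (by omega))
    · have h1 := (hc u hu).2.2.2 x hxu.symm (by rintro rfl; exact hua hx.symm)
      have h2 := (hc u hu).2.2.1
      have h3 := hzero u (by omega)
      subst h3
      omega
  have key := H.ncard_add_ncard_eq hU (S := S) (S' := S') hS ?_ ?_ hS' ?_ ?_
  · rw [himage S hS, himage S' hS'] at key
    have hinj : Set.InjOn m S := by
      rintro _ ⟨u, hu, rfl⟩ _ ⟨u', hu', rfl⟩ heq
      exact hcol u hu u' hu' heq
    rw [hinj.ncard_image] at key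
    have hinj' : Set.InjOn m S' := Set.injOn_of_ncard_image_eq (by omega)
    refine hne (hinj' (.inr (.inr rfl)) (.inr (.inl rfl)) ?_)
    rw [hmv w hw.1 hw.2, hmv w' hw'.1 hw'.2]
  · exact fun u hu => ⟨c u, ⟨u, hu, rfl⟩, (hc u hu).1⟩
  · rintro _ ⟨u, hu, rfl⟩
    have hmu := hm _ (hc2 u hu)
    refine ⟨m (c u), hmu.1.1.symm, ?_⟩
    rintro _ ⟨u', hu', rfl⟩ hadj
    exact (hcol u hu u' hu' ((hm _ (hc2 u' hu')).2 _ hadj.symm hmu.1.2)).symm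
  · intro u hu
    by_cases h1 : T.Adj u w
    · exact ⟨w, .inr (.inl rfl), h1⟩
    by_cases h2 : T.Adj u w'
    · exact ⟨w', .inr (.inr rfl), h2⟩
    exact ⟨c u, .inl ⟨u, ⟨hu, h1, h2⟩, rfl⟩, (hc u hu).1⟩
  · rintro _ (⟨u, hu, rfl⟩ | rfl | rfl)
    · have hmu := hm _ (hc2 u hu.1)
      refine ⟨m (c u), hmu.1.1.symm, ?_⟩
      rintro s' hs' hadj
      have heq := (hm _ (hS' s' hs')).2 _ hadj.symm hmu.1.2
      rcases hs' with ⟨u', hu', rfl⟩ | rfl | rfl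
      · exact (hcol u hu.1 u' hu'.1 heq).symm
      · exact absurd (heq.trans (hmv _ hw.1 hw.2)) (hcolv u hu.1)
      · exact absurd (heq.trans (hmv _ hw'.1 hw'.2)) (hcolv u hu.1)
    · obtain ⟨x, hxa, hxb, hxc⟩ := hprivw _ w' hw.1 hw.2 hw'.1 hw'.2 (Ne.symm hne)
      refine ⟨x, hxa, ?_⟩
      rintro _ (⟨u, hu, rfl⟩ | rfl | rfl) hadj
      exacts [absurd hadj (hxc u hu.1 hu.2.1), rfl, absurd hadj hxb]
    · obtain ⟨x, hxa, hxb, hxc⟩ := hprivw _ w hw'.1 hw'.2 hw.1 hw.2 hne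
      refine ⟨x, hxa, ?_⟩
      rintro _ (⟨u, hu, rfl⟩ | rfl | rfl) hadj
      exacts [absurd hadj (hxc u hu.1 hu.2.2), absurd hadj hxb, rfl]

end Matching

/-! ### Removing and reattaching pendant paths -/

section Peeling

universe u

variable {V : Type u} {T : SimpleGraph V} {h : V → ℕ}

/-- A height function for which the edges between the vertices of height `1` and those of height
`2` form a perfect matching. -/
structure MatchedHeight {V : Type*} (T : SimpleGraph V) (h : V → ℕ) : Prop
    extends HeightFunction T h where
  up : ∀ y, h y = 1 → ∃! w, T.Adj y w ∧ h w = 2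
  match_down : ∀ w, h w = 2 → ∃! y, T.Adj w y ∧ h y = 1

/-- The vertices `p 0, …, p n` form a path that is joined to the rest of the graph only by an edge
from `v` to `p n`. -/
structure PendantPath {V : Type*} (T : SimpleGraph V) (v : V) (n : ℕ) (p : Fin (n + 1) → V) :
    Prop where
  inj : Function.Injective p
  notMem : v ∉ Set.range p
  adj : ∀ i x, T.Adj (p i) x ↔ (∃ j, (path n).Adj i j ∧ p j = x) ∨ (i = Fin.last n ∧ x = v)

theorem PendantPath.adj_outside {v : V} {n : ℕ} {p : Fin (n + 1) → V} (hp : PendantPath T v n p)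
    {x : V} (hx : x ∉ Set.range p) (i : Fin (n + 1)) :
    T.Adj x (p i) ↔ x = v ∧ i = Fin.last n := by
  rw [T.adj_comm, hp.adj]
  constructor
  · rintro (⟨j, -, rfl⟩ | h)
    exacts [absurd ⟨j, rfl⟩ hx, h.symm]
  · exact fun h => .inr h.symm

theorem PendantPath.adj_inside {v : V} {n : ℕ} {p : Fin (n + 1) → V} (hp : PendantPath T v n p)
    (i j : Fin (n + 1)) : T.Adj (p i) (p j) ↔ (path n).Adj i j := by
  rw [hp.adj]
  constructor
  · rintro (⟨k, hk, he⟩ | ⟨-, he⟩)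
    · exact hp.inj he ▸ hk
    · exact absurd ⟨j, he⟩ hp.notMem
  · exact fun h => .inl ⟨j, h, rfl⟩

theorem PendantPath.nonempty_iso_edgeJoin {v : V} {n : ℕ} {p : Fin (n + 1) → V}
    (hp : PendantPath T v n p) {W : Type*} {G : SimpleGraph W}
    (φ : T.induce (Set.range p)ᶜ ≃g G) :
    Nonempty (T ≃g edgeJoin G (path n) (φ ⟨v, hp.notMem⟩) (Fin.last n)) := by
  let f : W ⊕ Fin (n + 1) → V := Sum.elim (fun x => (φ.symm x).1) p
  have hf : Function.Bijective f := by
    constructor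
    · rintro (x | i) (y | j) hxy
      · exact congrArg Sum.inl (φ.symm.injective (Subtype.ext hxy))
      · exact absurd ⟨j, hxy.symm⟩ (φ.symm x).2
      · exact absurd ⟨i, hxy⟩ (φ.symm y).2
      · exact congrArg Sum.inr (hp.inj hxy)
    · intro x
      by_cases hx : x ∈ Set.range p
      · obtain ⟨i, rfl⟩ := hx
        exact ⟨.inr i, rfl⟩
      · exact ⟨.inl (φ ⟨x, hx⟩), by simp [f]⟩
  have hmixed : ∀ x i, T.Adj (φ.symm x).1 (p i) ↔ x = φ ⟨v, hp.notMem⟩ ∧ i = Fin.last n := by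
    intro x i
    rw [hp.adj_outside (φ.symm x).2, ← φ.symm_apply_eq, Subtype.ext_iff]
  refine ⟨RelIso.symm ⟨Equiv.ofBijective f hf, ?_⟩⟩
  rintro (x | i) (y | j)
  · have := φ.symm.map_adj_iff (v := x) (w := y)
    simpa [edgeJoin, SimpleGraph.edge_adj, f] using this
  · simpa [edgeJoin, SimpleGraph.edge_adj, f] using hmixed x j
  · rw [SimpleGraph.adj_comm, SimpleGraph.adj_comm (edgeJoin _ _ _ _)]
    simpa [edgeJoin, SimpleGraph.edge_adj, f] using hmixed y i
  · simpa [edgeJoin, SimpleGraph.edge_adj, f] using hp.adj_inside i j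

/-- Collapsing the pendant path to `v` is a retraction that carries walks to reachability outside
the path. -/
theorem PendantPath.connected_induce {v : V} {n : ℕ} {p : Fin (n + 1) → V}
    (hp : PendantPath T v n p) (hT : T.Connected) : (T.induce (Set.range p)ᶜ).Connected := by
  classical
  let f : V → ↥(Set.range p)ᶜ := fun x => if hx : x ∈ Set.range p then ⟨v, hp.notMem⟩ else ⟨x, hx⟩
  have hf : ∀ x y, T.Adj x y → (T.induce (Set.range p)ᶜ).Reachable (f x) (f y) := by
    intro x y hxy
    by_cases hx : x ∈ Set.range p <;> by_cases hy : y ∈ Set.range p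
    · simp only [f, dif_pos hx, dif_pos hy]
      rfl
    · obtain ⟨i, rfl⟩ := hx
      obtain rfl := ((hp.adj_outside hy i).1 hxy.symm).1
      simp only [f, dif_pos (Set.mem_range_self i), dif_neg hy]
      rfl
    · obtain ⟨i, rfl⟩ := hy
      obtain rfl := ((hp.adj_outside hx i).1 hxy).1
      simp only [f, dif_pos (Set.mem_range_self i), dif_neg hx]
      rfl
    · simp only [f, dif_neg hx, dif_neg hy]
      exact SimpleGraph.Adj.reachable hxy
  have hwalk : ∀ x y, T.Walk x y → (T.induce (Set.range p)ᶜ).Reachable (f x) (f y) := by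
    intro x y w
    induction w with
    | nil => rfl
    | cons hadj _ ih => exact (hf _ _ hadj).trans ih
  have hfx : ∀ x : ↥(Set.range p)ᶜ, f x = x := fun x => dif_neg x.2
  refine (SimpleGraph.connected_iff _).2 ⟨fun x y => ?_, ⟨⟨v, hp.notMem⟩⟩⟩
  obtain ⟨w⟩ := hT x.1 y.1
  have := hwalk _ _ w
  rwa [hfx, hfx] at this

/-- Only `v` loses a neighbor. It keeps the lower neighbor `b`, and `c` prevents it from becoming a
leaf; `h1` and `h2` say that the cut edge is not a matching edge. -/
theorem MatchedHeight.induce (M : MatchedHeight T h) {v : V} {n : ℕ} {p : Fin (n + 1) → V}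
    (hp : PendantPath T v n p) (hv : h v ≠ 0) {b c t : V} (hb : T.Adj v b) (hc : T.Adj v c)
    (hbc : b ≠ c) (hbp : b ∉ Set.range p) (hcp : c ∉ Set.range p) (hbv : h v = h b + 1)
    (ht : h t = 3) (htp : t ∉ Set.range p) (h1 : h v = 1 → h (p (Fin.last n)) ≠ 2)
    (h2 : h v = 2 → h (p (Fin.last n)) ≠ 1) :
    MatchedHeight (T.induce (Set.range p)ᶜ) (fun x => h x.1) := by
  have hout : ∀ x, x ∉ Set.range p → x ≠ v → ∀ y, T.Adj x y → y ∉ Set.range p := by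
    rintro x hx hxv _ hxy ⟨i, rfl⟩
    exact hxv ((hp.adj_outside hx i).1 hxy).1
  have hvout : ∀ y, T.Adj v y → y ∈ Set.range p → y = p (Fin.last n) := by
    rintro _ hvy ⟨i, rfl⟩
    rw [((hp.adj_outside hp.notMem i).1 hvy).2]
  refine ⟨⟨?_, fun x y hxy => M.adj x y hxy, fun x => M.le_three x, ?_, ⟨t, htp⟩, ht⟩, ?_, ?_⟩
  · rintro ⟨x, hx⟩
    by_cases hxv : x = v
    · subst hxv
      refine ⟨fun h => absurd h hv, ?_⟩
      rintro ⟨z, -, hu⟩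
      have e1 := hu ⟨b, hbp⟩ hb
      have e2 := hu ⟨c, hcp⟩ hc
      exact absurd (congrArg Subtype.val (e1.trans e2.symm)) hbc
    · rw [M.leaf]
      constructor
      · rintro ⟨z, hz, hu⟩
        exact ⟨⟨z, hout x hx hxv z hz⟩, hz, fun y hy => Subtype.ext (hu y hy)⟩
      · rintro ⟨z, hz, hu⟩
        exact ⟨z, hz, fun y hy => congrArg Subtype.val (hu ⟨y, hout x hx hxv y hy⟩ hy)⟩
  · rintro ⟨x, hx⟩ k hk
    by_cases hxv : x = v
    · subst hxv
      refine ⟨⟨b, hbp⟩, hb, ?_⟩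
      have hk : h x = k + 1 := hk
      change h b = k
      omega
    · obtain ⟨z, hz, hzk⟩ := M.down x k hk
      exact ⟨⟨z, hout x hx hxv z hz⟩, hz, hzk⟩
  · rintro ⟨y, hy⟩ hy1
    obtain ⟨w, hw, hu⟩ := M.up y hy1
    refine ⟨⟨w, ?_⟩, hw, fun z hz => Subtype.ext (hu z hz)⟩
    by_cases hyv : y = v
    · subst hyv
      intro hwp
      exact h1 hy1 (hvout w hw.1 hwp ▸ hw.2)
    · exact hout y hy hyv w hw.1
  · rintro ⟨y, hy⟩ hy1
    obtain ⟨w, hw, hu⟩ := M.match_down y hy1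
    refine ⟨⟨w, ?_⟩, hw, fun z hz => Subtype.ext (hu z hz)⟩
    by_cases hyv : y = v
    · subst hyv
      intro hwp
      exact h2 hy1 (hvout w hw.1 hwp ▸ hw.2)
    · exact hout y hy hyv w hw.1

theorem HeightFunction.iso (H : HeightFunction T h) {W : Type*} {G : SimpleGraph W} (φ : T ≃g G) :
    HeightFunction G (fun x => h (φ.symm x)) := by
  have hadj : ∀ x y, G.Adj x y ↔ T.Adj (φ.symm x) (φ.symm y) := fun x y =>
    φ.symm.map_adj_iff.symm
  refine ⟨fun x => ?_, fun x y hxy => H.adj _ _ ((hadj x y).1 hxy), fun x => H.le_three _,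
    fun x k hk => ?_, ?_⟩
  · simp only [H.leaf, hadj]
    exact φ.symm.bijective.existsUnique_iff (p := fun z => T.Adj (φ.symm x) z)
  · obtain ⟨z, hz, hzk⟩ := H.down _ k hk
    exact ⟨φ z, by simpa [hadj] using hz, by simpa using hzk⟩
  · obtain ⟨z, hz⟩ := H.exists_three
    exact ⟨φ z, by simpa using hz⟩

/-- The vertex type of `attachWhisker` depends on a height; a free `n` allows substitution instead
of a cast. -/
theorem attachWhisker_iso {G : BundledGraph} (v : Attachable G) {n : ℕ}
    (hn : whiskerIndex (vertexHeight G.graph v.1) = n)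
    (hT : Nonempty (T ≃g edgeJoin G.graph (path n) v.1 (Fin.last n))) :
    Nonempty (T ≃g (attachWhisker G v).graph) := by
  subst hn
  exact hT

theorem PendantPath.exists_vertexSeq {v : V} {n : ℕ} {p : Fin (n + 1) → V}
    (hp : PendantPath T v n p) (hT : T.Connected) (hv : h v ≠ 0) (hn : whiskerIndex (h v) = n)
    (H : HeightFunction (T.induce (Set.range p)ᶜ) (fun x => h x.1)) {G : BundledGraph} {k : ℕ}
    {s : VertexSeq G k} (hs : Nonempty (T.induce (Set.range p)ᶜ ≃g (attachWhiskers G s).graph)) :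
    ∃ s' : VertexSeq G (k + 1), Nonempty (T ≃g (attachWhiskers G s').graph) := by
  obtain ⟨φ⟩ := hs
  have hconn := hp.connected_induce hT
  have hheight : vertexHeight (attachWhiskers G s).graph (φ ⟨v, hp.notMem⟩) = h v := by
    rw [(H.iso φ).vertexHeight_eq (φ.connected_iff.1 hconn)]
    simp
  have h3 := H.le_three ⟨v, hp.notMem⟩
  let a : Attachable (attachWhiskers G s) :=
    ⟨φ ⟨v, hp.notMem⟩, by rw [hheight]; omega, by rw [hheight]; exact h3⟩
  refine ⟨⟨s, a⟩, ?_⟩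
  exact attachWhisker_iso a (by rw [← hn, ← hheight]) (hp.nonempty_iso_edgeJoin φ)

end Peeling

/-! ### Finding a whisker, and the induction -/

section Decomposition

universe u

variable {V : Type u} {T : SimpleGraph V} {h : V → ℕ}

/-- The path that hangs at a vertex of height `2` when no two leaves have a common neighbor. -/
theorem MatchedHeight.exists_arm (M : MatchedHeight T h)
    (htwin : ∀ y l l', T.Adj y l → T.Adj y l' → h l = 0 → h l' = 0 → l = l') {w u : V}
    (hw : h w = 2) (hu : ∀ x, T.Adj w x ∧ h x = 3 ↔ x = u) :
    ∃ y l, h y = 1 ∧ h l = 0 ∧ (∀ x, T.Adj l x ↔ x = y) ∧ (∀ x, T.Adj y x ↔ x = l ∨ x = w) ∧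
      ∀ x, T.Adj w x ↔ x = y ∨ x = u := by
  obtain ⟨y, ⟨hwy, hy⟩, hyu⟩ := M.match_down w hw
  obtain ⟨l, hyl, hl⟩ := M.down y 0 hy
  refine ⟨y, l, hy, hl, fun x => ⟨fun hx => ((M.leaf l).1 hl).unique hx hyl.symm, ?_⟩,
    fun x => ⟨fun hx => ?_, ?_⟩, fun x => ⟨fun hx => ?_, ?_⟩⟩
  · rintro rfl
    exact hyl.symm
  · rcases M.adj y x hx with h1 | h1
    · exact .inl (htwin y x l hx hyl (by omega) hl)
    · exact .inr ((M.up y hy).unique ⟨hx, by omega⟩ ⟨hwy.symm, hw⟩)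
  · rintro (rfl | rfl)
    exacts [hyl, hwy.symm]
  · rcases M.adj w x hx with h1 | h1
    · exact .inl (hyu x ⟨hx, by omega⟩)
    · exact .inr ((hu x).1 ⟨hx, by omega⟩)
  · rintro (rfl | rfl)
    exacts [hwy, ((hu x).2 rfl).1]

/-- A vertex of height `2` at maximal distance from a root has a unique neighbor of height `3`. -/
theorem MatchedHeight.exists_unique_height_three_neighbor [Finite V] (M : MatchedHeight T h)
    (hT : T.IsTree) : ∃ w u, h w = 2 ∧ ∀ x, T.Adj w x ∧ h x = 3 ↔ x = u := by
  obtain ⟨t, ht⟩ := M.exists_three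
  obtain ⟨w₀, -, hw₀⟩ := M.down t 2 ht
  obtain ⟨w, hw, hmax⟩ := Set.exists_max_image {x | h x = 2} (T.dist t) (Set.toFinite _) ⟨w₀, hw₀⟩
  replace hw : h w = 2 := hw
  obtain ⟨y, ⟨hwy, hy⟩, hyu⟩ := M.match_down w hw
  obtain ⟨u, hu, huy⟩ := M.exists_ne_neighbor (by omega) hwy
  have hu3 : h u = 3 := by
    rcases M.adj w u hu with h1 | h1
    · exact absurd (hyu u ⟨hu, by omega⟩) huy
    · omega
  -- A height-3 neighbor farther from `t` would have a child, of height 2, beyond the maximum.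
  have hcloser : ∀ x, T.Adj w x → h x = 3 → T.dist t w = T.dist t x + 1 := by
    intro x hx hx3
    rcases hT.dist_eq_dist_add_one_of_adj t hx with h1 | h1
    · exact h1
    · obtain ⟨z, hz, hzd⟩ := M.exists_child hT t (v := x) (by omega)
      have h2 := M.adj x z hz
      have h3 := M.le_three z
      have h4 := hmax z (show h z = 2 by omega)
      omega
  refine ⟨w, u, hw, fun x => ⟨fun hx => ?_, ?_⟩⟩
  · exact tree_closer_neighbor_unique hT t hx.1 hu (hcloser x hx.1 hx.2) (hcloser u hu hu3)
  · rintro rfl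
    exact ⟨hu, hu3⟩

theorem nonempty_iso_path {n : ℕ} (hT : T.Connected) {f : Fin (n + 1) → V}
    (hinj : Function.Injective f) (hadj : ∀ i x, T.Adj (f i) x ↔ ∃ j, (path n).Adj i j ∧ f j = x) :
    Nonempty (T ≃g path n) := by
  have hsurj : Function.Surjective f := Set.range_eq_univ.1 <|
    eq_univ_of_adj_closed hT (Set.range_nonempty f) (by
      rintro _ ⟨i, rfl⟩ y hy
      obtain ⟨j, -, rfl⟩ := (hadj i y).1 hy
      exact ⟨j, rfl⟩)
  refine ⟨RelIso.symm ⟨Equiv.ofBijective f ⟨hinj, hsurj⟩, ?_⟩⟩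
  intro i j
  change T.Adj (f i) (f j) ↔ _
  rw [hadj]
  constructor
  · rintro ⟨k, hk, he⟩
    exact hinj he ▸ hk
  · exact fun h => ⟨j, h, rfl⟩

/-- If two leaves share a neighbor, one is cut off. Otherwise an arm `l, y, w` hangs at a height-3
vertex `u`. If `u` has degree at least 3, the arm is cut at `u`. If `u` has just one other neighbor
`w'`, then `l, y, w, u` is cut at `w'`, provided `w'` has another height-3 neighbor; if not, a
second arm hangs at `u` through `w'`, and the tree is P₆. -/
theorem MatchedHeight.iso_path_or_exists_pendantPath [Finite V] (M : MatchedHeight T h)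
    (hT : T.IsTree) : Nonempty (T ≃g path 6) ∨
      ∃ (v : V) (n : ℕ) (p : Fin (n + 1) → V), PendantPath T v n p ∧ h v ≠ 0 ∧
        whiskerIndex (h v) = n ∧ MatchedHeight (T.induce (Set.range p)ᶜ) (fun x => h x.1) := by
  by_cases htwin : ∀ y l l', T.Adj y l → T.Adj y l' → h l = 0 → h l' = 0 → l = l'
  swap
  · push Not at htwin
    obtain ⟨y, l, l', hyl, hyl', hl, hl', hne⟩ := htwin
    right
    have hy : h y = 1 := by
      have := M.adj y l hyl
      omega
    obtain ⟨w, hyw, hw⟩ := (M.up y hy).exists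
    obtain ⟨t, ht⟩ := M.exists_three
    have hrange : ∀ x, x ∉ Set.range ![l] ↔ x ≠ l := by simp
    have hp : PendantPath T y 0 ![l] := by
      refine ⟨fun i j _ => by fin_cases i; fin_cases j; rfl, ?_, fun i x => ?_⟩
      · rw [hrange]
        rintro rfl
        omega
      · fin_cases i
        have : T.Adj l x ↔ x = y :=
          ⟨fun hx => ((M.leaf l).1 hl).unique hx hyl.symm, by rintro rfl; exact hyl.symm⟩
        simp [this]
    have hlast : h (![l] (Fin.last 0)) = 0 := hl
    refine ⟨y, 0, _, hp, by omega, by simp [hy, whiskerIndex],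
      M.induce hp (by omega) (b := l') (c := w) (t := t) hyl' hyw ?_ ?_ ?_ (by omega) ht ?_
        (by omega) (by omega)⟩
    · rintro rfl
      omega
    · exact (hrange _).2 hne.symm
    · rw [hrange]
      rintro rfl
      omega
    · rw [hrange]
      rintro rfl
      omega
  obtain ⟨w, u, hw, hwu⟩ := M.exists_unique_height_three_neighbor hT
  obtain ⟨y, l, hy, hl, hla, hya, hwa⟩ := M.exists_arm htwin hw hwu
  obtain ⟨huw, hu⟩ := (hwu u).2 rfl
  replace huw := huw.symm
  obtain ⟨w', huw', hne⟩ := M.exists_ne_neighbor (by omega) huw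
  have hu2 : ∀ x, T.Adj u x → h x = 2 := by
    intro x hx
    have := M.adj u x hx
    have := M.le_three x
    omega
  have hw' := hu2 w' huw'
  by_cases hdeg : ∃ w'', T.Adj u w'' ∧ w'' ≠ w ∧ w'' ≠ w'
  · right
    obtain ⟨w'', huw'', hne1, hne2⟩ := hdeg
    have hrange : ∀ x, x ∉ Set.range ![l, y, w] ↔ x ≠ l ∧ x ≠ y ∧ x ≠ w := by
      intro x
      simp [Matrix.range_cons, not_or]
      tauto
    have hp : PendantPath T u 2 ![l, y, w] := by
      refine ⟨?_, ?_, ?_⟩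
      · intro i j
        fin_cases i <;> fin_cases j <;> simp <;> rintro rfl <;> omega
      · rw [hrange]
        refine ⟨?_, ?_, ?_⟩ <;> rintro rfl <;> omega
      · intro i x
        fin_cases i <;> simp [Fin.exists_fin_succ, SimpleGraph.pathGraph_adj, hla, hya, hwa, eq_comm,
          or_comm]
    refine ⟨u, 2, _, hp, by omega, by simp [hu, whiskerIndex],
      M.induce hp (by omega) (b := w') (c := w'') (t := u) huw' huw'' hne2.symm ?_ ?_ (by omega)
        hu hp.notMem (by omega) (by omega)⟩
    · rw [hrange]
      refine ⟨?_, ?_, hne⟩ <;> rintro rfl <;> omega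
    · have := hu2 w'' huw''
      rw [hrange]
      refine ⟨?_, ?_, hne1⟩ <;> rintro rfl <;> omega
  have hua : ∀ x, T.Adj u x ↔ x = w ∨ x = w' := by
    intro x
    constructor
    · intro hx
      by_contra hno
      exact hdeg ⟨x, hx, fun h => hno (.inl h), fun h => hno (.inr h)⟩
    · rintro (rfl | rfl)
      exacts [huw, huw']
  by_cases hdeg' : ∃ u', T.Adj w' u' ∧ h u' = 3 ∧ u' ≠ u
  · right
    obtain ⟨u', hwu', hu', hne'⟩ := hdeg'
    obtain ⟨y', hwy', hy'⟩ := M.down w' 1 hw'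
    have hrange : ∀ x, x ∉ Set.range ![l, y, w, u] ↔ x ≠ l ∧ x ≠ y ∧ x ≠ w ∧ x ≠ u := by
      intro x
      simp [Matrix.range_cons, not_or]
      tauto
    have hp : PendantPath T w' 3 ![l, y, w, u] := by
      refine ⟨?_, ?_, ?_⟩
      · intro i j
        fin_cases i <;> fin_cases j <;> simp <;> rintro rfl <;> omega
      · rw [hrange]
        refine ⟨?_, ?_, hne, ?_⟩ <;> rintro rfl <;> omega
      · intro i x
        fin_cases i <;>
          simp [Fin.exists_fin_succ, SimpleGraph.pathGraph_adj, hla, hya, hwa, hua, eq_comm,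
            or_comm]
    have hlast : h (![l, y, w, u] (Fin.last 3)) = 3 := hu
    refine ⟨w', 3, _, hp, by omega, by simp [hw', whiskerIndex],
      M.induce hp (by omega) (b := y') (c := u') (t := u') hwy' hwu' ?_ ?_ ?_ (by omega)
        hu' ?_ (by omega) (by omega)⟩
    · rintro rfl
      omega
    · rw [hrange]
      refine ⟨?_, ?_, ?_, ?_⟩
      · rintro rfl
        omega
      · rintro rfl
        rcases (hya w').1 hwy'.symm with h | h
        · rw [h] at hw'
          omega
        · exact hne h
      · rintro rfl
        omega
      · rintro rfl
        omega
    · rw [hrange]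
      refine ⟨?_, ?_, ?_, hne'⟩ <;> rintro rfl <;> omega
    · rw [hrange]
      refine ⟨?_, ?_, ?_, hne'⟩ <;> rintro rfl <;> omega
  left
  have hwu' : ∀ x, T.Adj w' x ∧ h x = 3 ↔ x = u := by
    intro x
    constructor
    · intro hx
      by_contra hno
      exact hdeg' ⟨x, hx.1, hx.2, hno⟩
    · rintro rfl
      exact ⟨huw'.symm, hu⟩
  obtain ⟨y', l', hy', hl', hla', hya', hwa'⟩ := M.exists_arm htwin hw' hwu'
  have hyy : y ≠ y' := by
    rintro rfl
    rcases (hya w').1 ((hya' w').2 (.inr rfl)) with h | h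
    · rw [h] at hw'
      omega
    · exact hne h
  have hll : l ≠ l' := by
    rintro rfl
    exact hyy ((hla' y).1 ((hla y).2 rfl))
  have hinj : Function.Injective ![l, y, w, u, w', y', l'] := by
    rw [← List.nodup_ofFn]
    -- Heights along the path are 0, 1, 2, 3, 2, 1, 0, so only the three mirror pairs need separate
    -- arguments.
    have hlt : ∀ a b, h a ≠ h b → a ≠ b := fun a b hab he => hab (he ▸ rfl)
    simp [List.ofFn_succ, hll, hyy, hne.symm, hlt, hl, hy, hw, hu, hw', hy', hl']
  refine nonempty_iso_path hT.connected hinj fun i x => ?_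
  fin_cases i <;>
    simp [Fin.exists_fin_succ, SimpleGraph.pathGraph_adj, hla, hya, hwa, hua, hla', hya', hwa',
      eq_comm, or_comm]

theorem MatchedHeight.exists_vertexSeq : ∀ (N : ℕ) {V : Type u} [Finite V] {T : SimpleGraph V}
    {h : V → ℕ}, MatchedHeight T h → T.IsTree → Nat.card V = N →
      ∃ (k : ℕ) (s : VertexSeq P6 k), Nonempty (T ≃g (attachWhiskers P6 s).graph) := by
  intro N
  induction N using Nat.strong_induction_on with
  | _ N ih =>
    intro V _ T h M hT hN
    rcases M.iso_path_or_exists_pendantPath hT with hiso | ⟨v, n, p, hp, hv, hn, M'⟩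
    · exact ⟨0, (), hiso⟩
    · have hcard : Nat.card ↥(Set.range p)ᶜ < N :=
        hN ▸ Finite.card_subtype_lt (x := p 0) (fun hx => hx ⟨0, rfl⟩)
      obtain ⟨k, s, hs⟩ := ih _ hcard M'
        ⟨hp.connected_induce hT.connected, hT.isAcyclic.induce _⟩ rfl
      obtain ⟨s', hs'⟩ := hp.exists_vertexSeq hT.connected hv hn M'.toHeightFunction hs
      exact ⟨k + 1, s', hs'⟩

end Decomposition

end WhiskerTrees

theorem mainTheorem8 {V : Type*} [Finite V] (T : SimpleGraph V) (hT : T.IsTree)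
    (hunmixed : WhiskerTrees.IsUnmixed T) (hbalanced : WhiskerTrees.IsBalanced T)
    (hheight : WhiskerTrees.graphHeight T = 3) :
    Nonempty (T ≃g WhiskerTrees.path 6) ∨
      ∃ (k : ℕ) (s : WhiskerTrees.VertexSeq WhiskerTrees.P6 k), 1 ≤ k ∧
        Nonempty (T ≃g (WhiskerTrees.attachWhiskers WhiskerTrees.P6 s).graph) := by
  have H := WhiskerTrees.heightFunction_vertexHeight hT hbalanced hheight
  have M : WhiskerTrees.MatchedHeight T (WhiskerTrees.vertexHeight T) :=
    { H with
      up := fun _ hy => H.existsUnique_height_two_neighbor hT hunmixed hy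
      match_down := fun _ hw => H.existsUnique_height_one_neighbor hT hunmixed hw }
  obtain ⟨k, s, hs⟩ := M.exists_vertexSeq _ hT rfl
  rcases Nat.eq_zero_or_pos k with rfl | hk
  · exact .inl hs
  · exact .inr ⟨k, s, hk, hs⟩
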